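/- Let $\Bbbk$ be a field, $n\ge 0$, and let $S=\Bbbk[x_1,\ldots,x_n]$ be the polynomial ring with the standard grading ($\deg x_j=1$) and homogeneous maximal ideal $\mathfrak m=(x_1,\ldots,x_n)$. For a finitely generated $\mathbb Z$-graded $S$-module $E$, let $\operatorname{depth}(E)$ be the supremum of the lengths of $E$-regular sequences in $\mathfrak m$, with $\operatorname{depth}(0)=+\infty$; let $\dim(E)$ be its Krull dimension, with $\dim(0)=-\infty$; and call $E\neq 0$ Cohen–Macaulay if $\operatorname{depth}(E)=\dim(E)$. Let $M$ be a finitely generated $\mathbb Z$-graded $S$-module. Call $M$ sequentially Cohen–Macaulay if, for every integer $i$, the module $\operatorname{Ext}^i_S(M,S)$ is either zero or Cohen–Macaulay of dimension $n-i$. For an integer $t\ge 0$, say that $M$ satisfies condition $(E_t)$ if $\operatorname{depth}(\operatorname{Ext}^i_S(M,S))\ge\min\{t,n-i\}$ for all $i$, and define $$\operatorname{E-depth}(M)=\min\bigl\{n,\ \sup\{t\in\mathbb Z_{\ge 0} : M\text{ satisfies }(E_t)\}\bigr\}.$$ Then the following are equivalent: (a) $M$ is sequentially Cohen–Macaulay;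 (b) $\operatorname{E-depth}(M)=n$; (c) $M$ satisfies condition $(E_t)$ for some integer $t\ge\max\{0,\dim(M)-1\}$. -/

import Mathlib

open CategoryTheory

universe u

namespace EDepth

/-- The polynomial ring `S = k[x₁, …, xₙ]`. -/
abbrev Poly (n : ℕ) (k : Type u) [Field k] : Type u := MvPolynomial (Fin n) k

/-- `M = ⨁ j, ℳ j` is a `ℤ`-grading of the `S`-module `M`, where `S = k[x₁, …, xₙ]` carries the
standard grading (every variable has degree one). -/
structure IsGrading {n : ℕ} {k : Type u} [Field k] {M : Type u} [AddCommGroup M]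
    [Module (Poly n k) M] (ℳ : ℤ → AddSubgroup M) : Prop where
  isInternal : DirectSum.IsInternal ℳ
  smul_mem : ∀ (i : ℕ) (j : ℤ) (f : Poly n k) (m : M),
    f.IsHomogeneous i → m ∈ ℳ j → f • m ∈ ℳ ((i : ℤ) + j)

open Classical in
/-- The depth of `E` in the ideal `I`: the supremum of the lengths of the `E`-regular sequences of
elements of `I`, with the convention that the zero module has depth `+∞`. -/
noncomputable def depthIn {R : Type*} [CommRing R] (I : Ideal R) (E : Type*) [AddCommGroup E]
    [Module R E] : ℕ∞ :=
  if Subsingleton E then ⊤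
  else ⨆ (rs : List R) (_ : (∀ r ∈ rs, r ∈ I) ∧ RingTheory.Sequence.IsRegular E rs),
    (rs.length : ℕ∞)

section

variable (n : ℕ) (k : Type u) [Field k]

/-- The depth of an `S`-module: its depth in the maximal homogeneous ideal `(x₁, …, xₙ)`. -/
noncomputable def depth (E : Type*) [AddCommGroup E] [Module (Poly n k) E] : ℕ∞ :=
  depthIn (MvPolynomial.idealOfVars (Fin n) k) E

/-- `E` is Cohen-Macaulay: a nonzero module with `depth E = dim E` (the zero module is excluded by
the equation, since its depth is `⊤` and its dimension is `⊥`). -/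
def IsCohenMacaulay (E : Type*) [AddCommGroup E] [Module (Poly n k) E] : Prop :=
  (depth n k E : WithBot ℕ∞) = Module.supportDim (Poly n k) E

variable (M : Type u) [AddCommGroup M] [Module (Poly n k) M]

/-- The `S`-module `Ext^i_S(M, S)`. It vanishes for `i < 0`, so only `i : ℕ` is considered. -/
abbrev ExtS (i : ℕ) : Type u :=
  Abelian.Ext (ModuleCat.of (Poly n k) M) (ModuleCat.of (Poly n k) (Poly n k)) i

/-- `M` is sequentially Cohen-Macaulay, in Peskine's formulation: for every `i`, the module
`Ext^i_S(M, S)` is zero, or Cohen-Macaulay of dimension `n - i`. -/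
def IsSequentiallyCohenMacaulay : Prop :=
  ∀ i : ℕ, Subsingleton (ExtS n k M i) ∨
    (IsCohenMacaulay n k (ExtS n k M i) ∧
      Module.supportDim (Poly n k) (ExtS n k M i) + (i : WithBot ℕ∞) = (n : WithBot ℕ∞))

/-- Condition `(E_t)`: `depth Ext^i_S(M, S) ≥ min {t, n - i}` for all `i`. For `i > n` the bound is
negative, hence void; so is the bound `0` given by the truncated subtraction. -/
def ConditionE (t : ℕ) : Prop :=
  ∀ i : ℕ, ((min t (n - i) : ℕ) : ℕ∞) ≤ depth n k (ExtS n k M i)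

/-- `E-depth(M) = min {n, sup {t | M satisfies (E_t)}}`. -/
noncomputable def eDepth : ℕ∞ :=
  min (n : ℕ∞) (⨆ (t : ℕ) (_ : ConditionE n k M t), (t : ℕ∞))

end

end EDepth

/-! The substance is (c) ⇒ (a). For every finitely generated M, each Ext^i(M,S) has dimension at
most n-i, so it is enough to show that every nonzero one has depth at least n-i. Let dim M ≤ t+1.
For i ≥ n-t this bound is (E_t) itself. For i ≤ n-t-2 Ischebeck's theorem gives Ext^i(M,S) = 0. Only
c = n-t-1 remains, where (E_t) yields t and t+1 is needed. All Ext below c vanish and all those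
above it have full depth, so a depth chase through the syzygies of M supplies the missing unit
(`extVanishesBelow_ext_of_forall_lt`, from `ExtVanishesBelow.ext_zero` and
`ExtVanishesBelow.ext_succ`).

Depth is handled as vanishing of Ext^j(S/𝔪, -) for small j, which obeys the depth lemma with no
exception for zero modules; Rees' theorem translates (`le_depth_iff`). The dimension bound and
Ischebeck's theorem both come from a prime filtration, reducing to M = S/q, and from cutting by an
element outside q; the former also uses Hilbert's syzygy theorem.

These arguments see only the point 𝔪. The grading enters to pass from local to global: Ext^i(M,S) is
zero once 𝔪 is outside its support. Instead of grading Ext, syzygies reduce this to Ext^0 and Ext^1,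
where linear forms are split into homogeneous components. -/

namespace EDepth

open Abelian

/-! ### Ext of modules: long exact sequences, annihilators, supports -/

section Ext

open scoped Pointwise

variable {R : Type u} [CommRing R]

/-- The module `Ext^i_R(M, N)`. -/
abbrev ExtR (R : Type u) [CommRing R] (M N : Type u) [AddCommGroup M] [Module R M]
    [AddCommGroup N] [Module R N] (i : ℕ) : Type u :=
  Abelian.Ext (ModuleCat.of R M) (ModuleCat.of R N) i

variable {M₁ M₂ M₃ N : Type u} [AddCommGroup M₁] [Module R M₁] [AddCommGroup M₂] [Module R M₂]
  [AddCommGroup M₃] [Module R M₃] [AddCommGroup N] [Module R N]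

/-- A linear map induces a linear map on `Ext` in the first variable. -/
noncomputable def extMapFst (f : M₁ →ₗ[R] M₂) (N : Type u) [AddCommGroup N] [Module R N] (i : ℕ) :
    ExtR R M₂ N i →ₗ[R] ExtR R M₁ N i :=
  (Ext.mk₀ (ModuleCat.ofHom f)).precompOfLinear R (ModuleCat.of R N) (zero_add i)

/-- A linear map induces a linear map on `Ext` in the second variable. -/
noncomputable def extMapSnd (f : M₁ →ₗ[R] M₂) (N : Type u) [AddCommGroup N] [Module R N] (i : ℕ) :
    ExtR R N M₁ i →ₗ[R] ExtR R N M₂ i :=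
  (Ext.mk₀ (ModuleCat.ofHom f)).postcompOfLinear R (ModuleCat.of R N) (add_zero i)

lemma shortExact_of_linearMap {f : M₁ →ₗ[R] M₂} {g : M₂ →ₗ[R] M₃} (hf : Function.Injective f)
    (hg : Function.Surjective g) (h : Function.Exact f g) :
    (ShortComplex.mk (ModuleCat.ofHom f) (ModuleCat.ofHom g)
      (by ext x; exact h.apply_apply_eq_zero x)).ShortExact where
  exact := (ShortComplex.ShortExact.moduleCat_exact_iff_function_exact _).mpr h
  mono_f := (ModuleCat.mono_iff_injective _).mpr hf
  epi_g := (ModuleCat.epi_iff_surjective _).mpr hg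

section LongExact

variable {f : M₁ →ₗ[R] M₂} {g : M₂ →ₗ[R] M₃} (hf : Function.Injective f)
  (hg : Function.Surjective g) (h : Function.Exact f g)

/-- The connecting map `Ext^i(M₁, N) → Ext^{i+1}(M₃, N)`. -/
noncomputable def extδFst (N : Type u) [AddCommGroup N] [Module R N] (i : ℕ) :
    ExtR R M₁ N i →ₗ[R] ExtR R M₃ N (i + 1) :=
  (shortExact_of_linearMap hf hg h).extClass.precompOfLinear R (ModuleCat.of R N) (add_comm 1 i)

lemma exact_extMapFst (hf : Function.Injective f)
    (hg : Function.Surjective g) (h : Function.Exact f g) (i : ℕ) :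
    Function.Exact (extMapFst g N i) (extMapFst f N i) :=
  (ShortComplex.ab_exact_iff_function_exact _).mp
    (Ext.contravariant_sequence_exact₂' (shortExact_of_linearMap hf hg h) (ModuleCat.of R N) i)

lemma exact_extMapFst_extδFst (i : ℕ) :
    Function.Exact (extMapFst f N i) (extδFst hf hg h N i) :=
  (ShortComplex.ab_exact_iff_function_exact _).mp
    (Ext.contravariant_sequence_exact₁' (shortExact_of_linearMap hf hg h) (ModuleCat.of R N)
      i (i + 1) (add_comm 1 i))

lemma exact_extδFst_extMapFst (i : ℕ) :
    Function.Exact (extδFst hf hg h N i) (extMapFst g N (i + 1)) :=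
  (ShortComplex.ab_exact_iff_function_exact _).mp
    (Ext.contravariant_sequence_exact₃' (shortExact_of_linearMap hf hg h) (ModuleCat.of R N)
      i (i + 1) (add_comm 1 i))

/-- The connecting map `Ext^i(N, M₃) → Ext^{i+1}(N, M₁)`. -/
noncomputable def extδSnd (N : Type u) [AddCommGroup N] [Module R N] (i : ℕ) :
    ExtR R N M₃ i →ₗ[R] ExtR R N M₁ (i + 1) :=
  (shortExact_of_linearMap hf hg h).extClass.postcompOfLinear R (ModuleCat.of R N) rfl

lemma exact_extMapSnd (hf : Function.Injective f)
    (hg : Function.Surjective g) (h : Function.Exact f g) (i : ℕ) :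
    Function.Exact (extMapSnd f N i) (extMapSnd g N i) :=
  (ShortComplex.ab_exact_iff_function_exact _).mp
    (Ext.covariant_sequence_exact₂' (ModuleCat.of R N) (shortExact_of_linearMap hf hg h) i)

lemma exact_extMapSnd_extδSnd (i : ℕ) :
    Function.Exact (extMapSnd g N i) (extδSnd hf hg h N i) :=
  (ShortComplex.ab_exact_iff_function_exact _).mp
    (Ext.covariant_sequence_exact₃' (ModuleCat.of R N) (shortExact_of_linearMap hf hg h)
      i (i + 1) rfl)

lemma exact_extδSnd_extMapSnd (i : ℕ) :
    Function.Exact (extδSnd hf hg h N i) (extMapSnd f N (i + 1)) :=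
  (ShortComplex.ab_exact_iff_function_exact _).mp
    (Ext.covariant_sequence_exact₁' (ModuleCat.of R N) (shortExact_of_linearMap hf hg h)
      i (i + 1) rfl)

lemma extMapSnd_zero_injective (hf : Function.Injective f) :
    Function.Injective (extMapSnd f N 0) :=
  have : Mono (ModuleCat.ofHom f) := (ModuleCat.mono_iff_injective _).mpr hf
  Ext.postcomp_mk₀_injective_of_mono _ _

lemma extMapFst_zero_injective (hg : Function.Surjective g) :
    Function.Injective (extMapFst g N 0) :=
  have : Epi (ModuleCat.ofHom g) := (ModuleCat.epi_iff_surjective _).mpr hg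
  Ext.precomp_mk₀_injective_of_epi _ _

end LongExact

/-- Linearly equivalent modules have the same `Ext`, in the first variable. -/
noncomputable def extEquivFst (e : M₁ ≃ₗ[R] M₂) (N : Type u) [AddCommGroup N] [Module R N] (i : ℕ) :
    ExtR R M₂ N i ≃ₗ[R] ExtR R M₁ N i :=
  LinearEquiv.ofLinearMap (extMapFst e.toLinearMap N i) (extMapFst e.symm.toLinearMap N i)
    (by
      ext x
      change (Ext.mk₀ _).comp ((Ext.mk₀ _).comp x (zero_add i)) (zero_add i) = x
      rw [Ext.mk₀_comp_mk₀_assoc, ← ModuleCat.ofHom_comp]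
      simp)
    (by
      ext x
      change (Ext.mk₀ _).comp ((Ext.mk₀ _).comp x (zero_add i)) (zero_add i) = x
      rw [Ext.mk₀_comp_mk₀_assoc, ← ModuleCat.ofHom_comp]
      simp)

lemma subsingleton_ext_of_projective [Module.Projective R M₁] (i : ℕ) :
    Subsingleton (ExtR R M₁ N (i + 1)) :=
  Ext.subsingleton_of_projective _ _ _

lemma subsingleton_ext_of_subsingleton_left [Subsingleton M₁] (i : ℕ) :
    Subsingleton (ExtR R M₁ N i) := by
  have h0 : 𝟙 (ModuleCat.of R M₁) = 0 := by ext x; exact Subsingleton.elim _ _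
  refine subsingleton_of_forall_eq 0 fun x ↦ ?_
  rw [← Ext.mk₀_id_comp x, h0, Ext.mk₀_zero, Ext.zero_comp]

lemma subsingleton_ext_of_subsingleton_right [Subsingleton N] (i : ℕ) :
    Subsingleton (ExtR R M₁ N i) := by
  have h0 : 𝟙 (ModuleCat.of R N) = 0 := by ext x; exact Subsingleton.elim _ _
  refine subsingleton_of_forall_eq 0 fun x ↦ ?_
  rw [← Ext.comp_mk₀_id x, h0, Ext.mk₀_zero, Ext.comp_zero]

lemma smul_ext_eq_zero_of_mem_annihilator {r : R} (hr : r ∈ Module.annihilator R M₁) {i : ℕ}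
    (x : ExtR R M₁ N i) : r • x = 0 := by
  have h0 : r • 𝟙 (ModuleCat.of R M₁) = 0 := by
    ext m
    exact Module.mem_annihilator.mp hr m
  rw [← Ext.mk₀_id_comp x, ← Ext.smul_comp, ← Ext.mk₀_smul, h0, Ext.mk₀_zero, Ext.zero_comp]

lemma annihilator_le_of_mem_support_ext {i : ℕ} {p : PrimeSpectrum R}
    (hp : p ∈ Module.support R (ExtR R M₁ N i)) : Module.annihilator R M₁ ≤ p.asIdeal :=
  le_trans (fun _ hr ↦ Module.mem_annihilator.mpr fun x ↦ smul_ext_eq_zero_of_mem_annihilator hr x)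
    (Module.annihilator_le_of_mem_support hp)

lemma support_ext_subset_of_exact {f : M₁ →ₗ[R] M₂} {g : M₂ →ₗ[R] M₃} (hf : Function.Injective f)
    (hg : Function.Surjective g) (h : Function.Exact f g) (i : ℕ) :
    Module.support R (ExtR R M₂ N i) ⊆
      Module.support R (ExtR R M₁ N i) ∪ Module.support R (ExtR R M₃ N i) := by
  intro p hp
  by_contra hcon
  rw [Set.mem_union, not_or, Module.notMem_support_iff', Module.notMem_support_iff'] at hcon
  refine (Module.notMem_support_iff'.mpr fun x ↦ ?_) hp
  obtain ⟨r, hr, hrx⟩ := hcon.1 (extMapFst f N i x)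
  rw [← map_smul] at hrx
  obtain ⟨y, hy⟩ := (exact_extMapFst hf hg h i _).mp hrx
  obtain ⟨s, hs, hsy⟩ := hcon.2 y
  refine ⟨s * r, fun hsr ↦ (p.2.mem_or_mem hsr).elim hs hr, ?_⟩
  rw [mul_smul, ← hy, ← map_smul, hsy, map_zero]

/-- If `x` is a nonzerodivisor on `M`, then `Ext^i(M, N) / x` embeds into `Ext^{i+1}(M / x, N)`. -/
lemma mem_support_ext_quotSMulTop [IsNoetherianRing R] [Module.Finite R M₁] [Module.Finite R N]
    {x : R} (hx : IsSMulRegular M₁ x) {i : ℕ} {p : PrimeSpectrum R} (hxp : x ∈ p.asIdeal)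
    (hp : p ∈ Module.support R (ExtR R M₁ N i)) :
    p ∈ Module.support R (ExtR R (QuotSMulTop x M₁) N (i + 1)) := by
  have hf : Function.Injective (LinearMap.lsmul R M₁ x) := hx
  have hg := Submodule.mkQ_surjective (x • (⊤ : Submodule R M₁))
  have h := LinearMap.exact_lsmul_mkQ_smul_top M₁ x
  have hmap : extMapFst (LinearMap.lsmul R M₁ x) N i = LinearMap.lsmul R _ x := by
    ext y
    change (Ext.mk₀ (x • 𝟙 (ModuleCat.of R M₁))).comp y (zero_add i) = x • y
    rw [Ext.mk₀_smul, Ext.smul_comp, Ext.mk₀_id_comp]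
  have hex := exact_extMapFst_extδFst (N := N) hf hg h i
  rw [hmap] at hex
  have hker : LinearMap.ker (extδFst hf hg h N i) = x • ⊤ := by
    ext y
    rw [LinearMap.mem_ker, hex y, Submodule.mem_smul_pointwise_iff_exists]
    simp
  -- Nakayama: Ext is finitely generated, so the support of its quotient by x is its support cut
  -- with V(x).
  have hmem : p ∈ Module.support R (QuotSMulTop x (ExtR R M₁ N i)) := by
    rw [Module.support_quotSMulTop]
    exact ⟨hp, by simpa using hxp⟩
  exact Module.support_subset_of_injective (Submodule.liftQ _ (extδFst hf hg h N i) hker.ge)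
    (LinearMap.ker_eq_bot.mp (Submodule.ker_liftQ_eq_bot _ _ _ hker.le)) hmem

end Ext


/-! ### Depth as vanishing of Ext, and the depth lemma -/

section DepthGE

variable {R : Type u} [CommRing R]

/-- All modules `Ext^j_R(R / I, E)` with `j < r` vanish. When `E` is finitely generated with
`I E ≠ E`, this says that the depth of `E` in `I` is at least `r`. -/
def ExtVanishesBelow (I : Ideal R) (r : ℕ) (E : Type u) [AddCommGroup E] [Module R E] : Prop :=
  ∀ j < r, Subsingleton (ExtR R (R ⧸ I) E j)

variable {I : Ideal R} {r s : ℕ} {A B C : Type u} [AddCommGroup A] [Module R A] [AddCommGroup B]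
  [Module R B] [AddCommGroup C] [Module R C]

lemma ExtVanishesBelow.mono (h : ExtVanishesBelow I s A) (hrs : r ≤ s) :
    ExtVanishesBelow I r A :=
  fun j hj ↦ h j (hj.trans_le hrs)

lemma ExtVanishesBelow.zero : ExtVanishesBelow I 0 A :=
  fun _ hj ↦ absurd hj (Nat.not_lt_zero _)

lemma ExtVanishesBelow.of_subsingleton [Subsingleton A] : ExtVanishesBelow I r A :=
  fun j _ ↦ subsingleton_ext_of_subsingleton_right j

lemma subsingleton_of_exact {X Y Z : Type*} [AddCommGroup X] [AddCommGroup Y] [AddCommGroup Z]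
    [Subsingleton X] [Subsingleton Z] {f : X → Y} {g : Y → Z} (h : Function.Exact f g)
    (hf : f 0 = 0) : Subsingleton Y := by
  refine subsingleton_of_forall_eq 0 fun y ↦ ?_
  obtain ⟨x, rfl⟩ := (h y).mp (Subsingleton.elim _ _)
  rw [Subsingleton.elim x 0, hf]

section ShortExact

variable {f : A →ₗ[R] B} {g : B →ₗ[R] C} (hf : Function.Injective f)
  (hg : Function.Surjective g) (h : Function.Exact f g)
include hf hg h

/-- This and the next two lemmas are the three forms of the depth lemma, read off the long exact
sequence of Ext(R/I, -). The connecting map raises the degree by one, so C may fall one short of the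
bound wanted for A, while A must exceed by one the bound wanted for C. -/
lemma ExtVanishesBelow.left (hB : ExtVanishesBelow I r B) (hC : ExtVanishesBelow I s C)
    (hrs : r ≤ s + 1) : ExtVanishesBelow I r A := by
  rintro (_ | j) hj
  · have := hB 0 hj
    exact (extMapSnd_zero_injective (N := R ⧸ I) hf).subsingleton
  · have := hB (j + 1) hj
    have := hC j (by lia)
    exact subsingleton_of_exact (exact_extδSnd_extMapSnd (N := R ⧸ I) hf hg h j) (map_zero _)

lemma ExtVanishesBelow.right (hB : ExtVanishesBelow I r B) (hA : ExtVanishesBelow I s A)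
    (hrs : r + 1 ≤ s) : ExtVanishesBelow I r C := by
  intro j hj
  have := hB j hj
  have := hA (j + 1) (by lia)
  exact subsingleton_of_exact (exact_extMapSnd_extδSnd (N := R ⧸ I) hf hg h j) (map_zero _)

lemma ExtVanishesBelow.middle (hA : ExtVanishesBelow I r A) (hC : ExtVanishesBelow I r C) :
    ExtVanishesBelow I r B := by
  intro j hj
  have := hA j hj
  have := hC j hj
  exact subsingleton_of_exact (exact_extMapSnd (N := R ⧸ I) hf hg h j) (map_zero _)

end ShortExact

lemma ExtVanishesBelow.of_equiv (e : A ≃ₗ[R] B) (hB : ExtVanishesBelow I r B) :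
    ExtVanishesBelow I r A :=
  hB.left (C := PUnit) (f := e.toLinearMap) (g := 0) (s := r) e.injective
    (Function.surjective_to_subsingleton _)
    ((LinearMap.exact_zero_iff_surjective _ _).mpr e.surjective) .of_subsingleton (by lia)

lemma ExtVanishesBelow.pi {ι : Type} [Finite ι] (h : ExtVanishesBelow I r A) :
    ExtVanishesBelow I r (ι → A) := by
  induction ι using Finite.induction_empty_option with
  | of_equiv e ih => exact .of_equiv (LinearEquiv.funCongrLeft R A e) ih
  | h_empty => exact .of_subsingleton
  | @h_option ι _ ih =>
    refine .of_equiv (B := A × (ι → A)) ?_ (.middle (f := LinearMap.inl R A (ι → A))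
      (g := LinearMap.snd R A (ι → A)) LinearMap.inl_injective LinearMap.snd_surjective
      .inl_snd h ih)
    exact LinearEquiv.piOptionEquivProd R

end DepthGE

/-! ### Depth of Ext(M, R) by chasing through syzygies -/

section SyzygyDepth

variable {R : Type u} [CommRing R]

/-- The exact sequences `0 → M* → F* → B → 0` and `0 → B → K* → Ext¹(M, N) → 0` coming from
`0 → K → F → M → 0` with `F` projective. -/
lemma exists_exact_of_projective {K F M : Type u} (N : Type u) [AddCommGroup K] [Module R K]
    [AddCommGroup F] [Module R F] [AddCommGroup M] [Module R M] [AddCommGroup N] [Module R N]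
    [Module.Projective R F] {f : K →ₗ[R] F} {g : F →ₗ[R] M} (hf : Function.Injective f)
    (hg : Function.Surjective g) (h : Function.Exact f g) :
    ∃ (B : Submodule R (ExtR R K N 0)) (u : ExtR R F N 0 →ₗ[R] B) ,
      Function.Surjective u ∧ Function.Exact (extMapFst g N 0) u ∧
      Function.Exact B.subtype (extδFst hf hg h N 0) ∧
      Function.Surjective (extδFst hf hg h N 0) := by
  refine ⟨LinearMap.range (extMapFst f N 0), (extMapFst f N 0).rangeRestrict,
    LinearMap.surjective_rangeRestrict _, fun x ↦ ?_, fun x ↦ ?_, fun x ↦ ?_⟩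
  · rw [← exact_extMapFst (N := N) hf hg h 0 x, Subtype.ext_iff]
    rfl
  · rw [exact_extMapFst_extδFst (N := N) hf hg h 0 x]
    simp
  · have := subsingleton_ext_of_projective (R := R) (M₁ := F) (N := N) 0
    exact (exact_extδFst_extMapFst (N := N) hf hg h 0 x).mp (Subsingleton.elim _ _)

/-- Dimension shifting: `Ext^{i+1}(K, N) ≃ Ext^{i+2}(M, N)` for `0 → K → F → M → 0` with `F`
projective. -/
lemma nonempty_extEquiv_of_projective {K F M : Type u} (N : Type u) [AddCommGroup K] [Module R K]
    [AddCommGroup F] [Module R F] [AddCommGroup M] [Module R M] [AddCommGroup N] [Module R N]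
    [Module.Projective R F] {f : K →ₗ[R] F} {g : F →ₗ[R] M} (hf : Function.Injective f)
    (hg : Function.Surjective g) (h : Function.Exact f g) (i : ℕ) :
    Nonempty (ExtR R K N (i + 1) ≃ₗ[R] ExtR R M N (i + 2)) := by
  have h1 := subsingleton_ext_of_projective (R := R) (M₁ := F) (N := N) i
  have h2 := subsingleton_ext_of_projective (R := R) (M₁ := F) (N := N) (i + 1)
  refine ⟨LinearEquiv.ofBijective (extδFst hf hg h N (i + 1)) ⟨?_, fun x ↦ ?_⟩⟩
  · rw [injective_iff_map_eq_zero]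
    intro x hx
    obtain ⟨y, rfl⟩ := (exact_extMapFst_extδFst (N := N) hf hg h (i + 1) x).mp hx
    rw [Subsingleton.elim y 0, map_zero]
  · exact (exact_extδFst_extMapFst (N := N) hf hg h (i + 1) x).mp (Subsingleton.elim _ _)

variable {I : Ideal R} {n : ℕ}

lemma ExtVanishesBelow.ext_zero_of_free {F N : Type u} [AddCommGroup F] [Module R F]
    [AddCommGroup N] [Module R N] [Module.Free R F] [Module.Finite R F]
    (hN : ExtVanishesBelow I n N) : ExtVanishesBelow I n (ExtR R F N 0) := by
  let b := Module.Free.chooseBasis R F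
  let e : ExtR R F N 0 ≃ₗ[R] (F →ₗ[R] N) :=
    CategoryTheory.Abelian.Ext.linearEquiv₀.trans ModuleCat.homLinearEquiv
  let b' := b.reindex (Fintype.equivFin _)
  exact .of_equiv (e.trans (b'.constr R).symm) hN.pi

variable [IsNoetherianRing R]

/-- Take 0 → K → F → M → 0 with F free. The modules Ext^{i+1}(K) are those of M shifted by one, so
induction bounds the depth of K*. The sequence 0 → B → K* → Ext¹(M) → 0 passes the bound to B, and 0
→ M* → F* → B → 0 gains one, up to the depth n of F*. -/
lemma ExtVanishesBelow.ext_zero (hR : ExtVanishesBelow I n R) (r : ℕ) (M : Type u)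
    [AddCommGroup M] [Module R M] [Module.Finite R M]
    (h : ∀ i, ExtVanishesBelow I (r - (i + 1)) (ExtR R M R (i + 1))) :
    ExtVanishesBelow I (min n (r + 1)) (ExtR R M R 0) := by
  induction r generalizing M with
  | zero =>
    obtain ⟨F, _, _, _, _, g, hg⟩ := Module.exists_finite_presentation R M
    obtain ⟨B, u, hu, h1, -, -⟩ :=
      exists_exact_of_projective R (LinearMap.ker g).injective_subtype hg
        (LinearMap.exact_subtype_ker_map g)
    exact (hR.ext_zero_of_free.mono (min_le_left _ _)).left (extMapFst_zero_injective hg) hu h1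
      (.zero) (by lia)
  | succ r ih =>
    obtain ⟨F, _, _, _, _, g, hg⟩ := Module.exists_finite_presentation R M
    have hex := LinearMap.exact_subtype_ker_map g
    obtain ⟨B, u, hu, h1, h2, h3⟩ :=
      exists_exact_of_projective R (LinearMap.ker g).injective_subtype hg hex
    have hK : ExtVanishesBelow I (min n (r + 1)) (ExtR R (LinearMap.ker g) R 0) := by
      refine ih _ fun i ↦ ?_
      obtain ⟨e⟩ := nonempty_extEquiv_of_projective R
        (LinearMap.ker g).injective_subtype hg hex i
      exact .of_equiv e ((h (i + 1)).mono (by lia))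
    have hB : ExtVanishesBelow I (min n (r + 1)) B :=
      hK.left B.injective_subtype h3 h2 (h 0) (by lia)
    exact (hR.ext_zero_of_free.mono (min_le_left _ _)).left (extMapFst_zero_injective hg) hu h1
      hB (by lia)

/-- Each syzygy lowers c by one and costs one unit of depth of the dual, which is why s + c + 2 is
asked of M*. In the application M* = 0, but the dual of a syzygy is not zero, so the induction needs
a depth bound in its place. -/
lemma ExtVanishesBelow.ext_succ (hR : ExtVanishesBelow I n R) (c s : ℕ) (hs : s + c + 1 ≤ n)
    (M : Type u) [AddCommGroup M] [Module R M] [Module.Finite R M]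
    (h0 : ExtVanishesBelow I (s + c + 2) (ExtR R M R 0))
    (hc : ∀ i < c, Subsingleton (ExtR R M R (i + 1)))
    (h : ∀ i, ExtVanishesBelow I (s - (i + 1)) (ExtR R M R (c + i + 2))) :
    ExtVanishesBelow I s (ExtR R M R (c + 1)) := by
  induction c generalizing M with
  | zero =>
    obtain ⟨F, _, _, _, _, g, hg⟩ := Module.exists_finite_presentation R M
    have hex := LinearMap.exact_subtype_ker_map g
    obtain ⟨B, u, hu, h1, h2, h3⟩ :=
      exists_exact_of_projective R (LinearMap.ker g).injective_subtype hg hex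
    have hB : ExtVanishesBelow I (s + 1) B :=
      (hR.ext_zero_of_free.mono (by lia)).right (extMapFst_zero_injective hg) hu h1 h0 (by lia)
    have hK : ExtVanishesBelow I (min n (s + 1)) (ExtR R (LinearMap.ker g) R 0) := by
      refine hR.ext_zero _ _ fun i ↦ ?_
      obtain ⟨e⟩ := nonempty_extEquiv_of_projective R
        (LinearMap.ker g).injective_subtype hg hex i
      exact .of_equiv e (by have := h i; rwa [Nat.zero_add] at this)
    -- Ext¹(M) is the cokernel of B → K*, and both terms have depth at least s + 1.
    exact (hK.mono (by lia)).right B.injective_subtype h3 h2 hB (by lia)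
  | succ c ih =>
    obtain ⟨F, _, _, _, _, g, hg⟩ := Module.exists_finite_presentation R M
    have hex := LinearMap.exact_subtype_ker_map g
    obtain ⟨B, u, hu, h1, h2, h3⟩ :=
      exists_exact_of_projective R (LinearMap.ker g).injective_subtype hg hex
    have hB : ExtVanishesBelow I (s + c + 2) B :=
      (hR.ext_zero_of_free.mono (by lia)).right (extMapFst_zero_injective hg) hu h1 h0 (by lia)
    have := hc 0 (by lia)
    have e := nonempty_extEquiv_of_projective R (LinearMap.ker g).injective_subtype hg hex
    refine .of_equiv (e c).some.symm (ih (by lia) _ ?_ (fun i hi ↦ ?_) fun i ↦ ?_)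
    -- Since Ext¹(M) = 0, K* is B and inherits its depth.
    · exact hB.middle B.injective_subtype h3 h2 .of_subsingleton
    · have := hc (i + 1) (by lia)
      exact (e i).some.toEquiv.subsingleton
    · refine .of_equiv (e (c + i + 1)).some ?_
      have := h i
      rwa [show c + 1 + i = c + i + 1 by lia] at this

end SyzygyDepth


/-! ### Dimension of Ext modules and Ischebeck's theorem -/

section Support

variable {R : Type u} [CommRing R]

lemma isSMulRegular_quotient_prime {M : Type*} [AddCommGroup M] [Module R M] {p : PrimeSpectrum R}
    (e : M ≃ₗ[R] R ⧸ p.asIdeal) {x : R} (hx : x ∉ p.asIdeal) : IsSMulRegular M x := by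
  rw [isSMulRegular_iff_right_eq_zero_of_smul]
  intro m hm
  obtain ⟨r, hr⟩ := Ideal.Quotient.mk_surjective (e m)
  have h0 : x • e m = 0 := by rw [← map_smul, hm, map_zero]
  rw [← hr, Algebra.smul_def, Ideal.Quotient.algebraMap_eq, ← map_mul,
    Ideal.Quotient.eq_zero_iff_mem] at h0
  have : e m = 0 := by
    rw [← hr, Ideal.Quotient.eq_zero_iff_mem]
    exact (p.2.mem_or_mem h0).resolve_left hx
  simpa using this

lemma annihilator_eq_of_equiv_quotient {M : Type*} [AddCommGroup M] [Module R M]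
    {I : Ideal R} (e : M ≃ₗ[R] R ⧸ I) : Module.annihilator R M = I := by
  rw [e.annihilator_eq, Ideal.annihilator_quotient]

/-- A chain of primes in the support is no longer than the coheight of its smallest member. -/
lemma supportDim_le_of_coheight_lt {M : Type*} [AddCommGroup M] [Module R M] {d : ℕ}
    (h : ∀ p ∈ Module.support R M, Order.coheight p < (d + 1 : ℕ)) :
    Module.supportDim R M ≤ d := by
  refine iSup_le fun s ↦ ?_
  have h1 := h _ s.head.2
  rw [Nat.cast_succ, ENat.lt_add_one_iff (ENat.natCast_ne_top d)] at h1
  have h2 := Order.coheight_le_iff.mp h1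
    (p := s.map (Subtype.val : Module.support R M → PrimeSpectrum R) fun _ _ h ↦ h) le_rfl
  exact_mod_cast h2

/-- The length of a regular sequence is at most the dimension. -/
lemma length_le_supportDim_of_isRegular (rs : List R) {M : Type u} [AddCommGroup M]
    [Module R M] [Module.Finite R M] (h : RingTheory.Sequence.IsRegular M rs) :
    (rs.length : WithBot ℕ∞) ≤ Module.supportDim R M := by
  induction rs generalizing M with
  | nil =>
    have := h.nontrivial
    obtain ⟨p, hp⟩ := Module.nonempty_support_of_nontrivial (R := R) (M := M)
    have : Nonempty (Module.support R M) := ⟨⟨p, hp⟩⟩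
    exact Order.krullDim_nonneg
  | cons x rs ih =>
    rw [RingTheory.Sequence.isRegular_cons_iff] at h
    rw [List.length_cons, Nat.cast_succ]
    exact (add_le_add_left (ih h.2) 1).trans
      (Module.supportDim_quotSMulTop_succ_le_of_notMem_minimalPrimes fun _ ↦
        h.1.notMem_of_mem_minimalPrimes)

variable [IsNoetherianRing R]

/-- If `Ext^i(-, N)` vanishes on finitely generated modules for `i = n + 1`, then the primes in the
support of `Ext^i(M, N)` have coheight at most `n - i`. -/
lemma coheight_add_le_of_mem_support_ext {N : Type u} [AddCommGroup N] [Module R N]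
    [Module.Finite R N] {n : ℕ}
    (hn : ∀ (M : Type u) [AddCommGroup M] [Module R M] [Module.Finite R M],
      Subsingleton (ExtR R M N (n + 1)))
    (d i : ℕ) (hd : i + d = n + 1) (M : Type u) [AddCommGroup M] [Module R M] [Module.Finite R M]
    (p : PrimeSpectrum R) (hp : p ∈ Module.support R (ExtR R M N i)) :
    Order.coheight p < d := by
  induction d generalizing i M p with
  | zero =>
    obtain rfl : i = n + 1 := hd
    have := hn M
    simp [Module.support_eq_empty] at hp
  | succ d ih =>
    induction ‹Module.Finite R M› using
      IsNoetherianRing.induction_on_isQuotientEquivQuotientPrime R generalizing p with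
    | subsingleton M =>
      have := subsingleton_ext_of_subsingleton_left (R := R) (M₁ := M) (N := N) i
      simp [Module.support_eq_empty] at hp
    | quotient M q e =>
      rw [Nat.cast_succ, ENat.lt_add_one_iff (ENat.natCast_ne_top d), Order.coheight_le_coe_iff]
      intro p' hp'
      -- For M = R/q and p strictly below p', an x in p' outside p is regular on M. Then p' lies in
      -- the support of Ext^{i+1}(M/x), and the induction bounds its coheight.
      obtain ⟨x, hxp', hxp⟩ := Set.exists_of_ssubset hp'
      have hqp : q.asIdeal ≤ p.asIdeal := by
        rw [← annihilator_eq_of_equiv_quotient e]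
        exact annihilator_le_of_mem_support_ext hp
      exact ih (i + 1) (by lia) _ p' (mem_support_ext_quotSMulTop
        (isSMulRegular_quotient_prime e fun h ↦ hxp (hqp h)) hxp'
        (Module.mem_support_mono hp'.le hp))
    | exact M₁ M₂ M₃ f g hf hg h h₁ h₃ =>
      exact (support_ext_subset_of_exact hf hg h i hp).elim (h₁ p) (h₃ p)

/-- A local form of Ischebeck's theorem. -/
lemma notMem_support_ext_of_supportDim_lt {N : Type u} [AddCommGroup N] [Module R N]
    [Module.Finite R N] {n : ℕ} {m : PrimeSpectrum R} (hm : ExtVanishesBelow m.asIdeal n N)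
    (d : ℕ) (M : Type u) [AddCommGroup M] [Module R M] [Module.Finite R M]
    (hM : Module.supportDim R M < d) (i : ℕ) (hi : i + d ≤ n) :
    m ∉ Module.support R (ExtR R M N i) := by
  induction d generalizing i M with
  | zero =>
    have : Subsingleton M := by
      rw [← Module.supportDim_eq_bot_iff_subsingleton R]
      exact (WithBot.lt_zero_iff_eq_bot _).mp (by simpa using hM)
    have := subsingleton_ext_of_subsingleton_left (R := R) (M₁ := M) (N := N) i
    simp [Module.support_eq_empty]
  | succ d ih =>
    induction ‹Module.Finite R M› using
      IsNoetherianRing.induction_on_isQuotientEquivQuotientPrime R with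
    | subsingleton M =>
      have := subsingleton_ext_of_subsingleton_left (R := R) (M₁ := M) (N := N) i
      simp [Module.support_eq_empty]
    | quotient M q e =>
      intro hmem
      have hqm : q.asIdeal ≤ m.asIdeal := by
        rw [← annihilator_eq_of_equiv_quotient e]
        exact annihilator_le_of_mem_support_ext hmem
      -- If q = m, the vanishing of Ext^i(R/m, N) is the hypothesis on N. Otherwise an x in m
      -- outside q is regular on R/q; dividing by it lowers the dimension and raises i by one.
      by_cases hmq : m.asIdeal ≤ q.asIdeal
      · have hqm' : q = m := PrimeSpectrum.ext (le_antisymm hqm hmq)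
        subst hqm'
        have := hm i (by lia)
        have := (extEquivFst e N i).toEquiv.symm.subsingleton
        simp [Module.support_eq_empty] at hmem
      · obtain ⟨x, hxm, hxq⟩ := SetLike.not_le_iff_exists.mp hmq
        have hreg := isSMulRegular_quotient_prime e hxq
        refine ih (QuotSMulTop x M) ?_ (i + 1) (by lia)
          (mem_support_ext_quotSMulTop hreg hxm hmem)
        have h1 := (Module.supportDim_quotSMulTop_succ_le_of_notMem_minimalPrimes fun _ ↦
          hreg.notMem_of_mem_minimalPrimes).trans_lt hM
        rw [Nat.cast_succ] at h1
        exact lt_of_add_lt_add_right h1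
    | exact M₁ M₂ M₃ f g hf hg h h₁ h₃ =>
      intro hmem
      exact (support_ext_subset_of_exact hf hg h i hmem).elim
        (h₁ ((Module.supportDim_le_of_injective f hf).trans_lt hM))
        (h₃ ((Module.supportDim_le_of_surjective g hg).trans_lt hM))

end Support


/-! ### Hilbert's syzygy theorem -/

section GlobalDimension

open scoped Polynomial TensorProduct

variable {A : Type u} [CommRing A]

lemma shortExact_baseChange (B : Type u) [CommRing B] [Algebra A B] [Module.Flat A B]
    {M₁ M₂ M₃ : Type u} [AddCommGroup M₁] [Module A M₁] [AddCommGroup M₂] [Module A M₂]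
    [AddCommGroup M₃] [Module A M₃] {f : M₁ →ₗ[A] M₂} {g : M₂ →ₗ[A] M₃}
    (hf : Function.Injective f) (hg : Function.Surjective g) (h : Function.Exact f g) :
    (ShortComplex.mk (ModuleCat.ofHom (f.baseChange B)) (ModuleCat.ofHom (g.baseChange B))
      (ModuleCat.hom_ext (LinearMap.ext (lTensor_exact B h hg).apply_apply_eq_zero))).ShortExact :=
  shortExact_of_linearMap (R := B) (f := f.baseChange B) (g := g.baseChange B)
    (Module.Flat.lTensor_preserves_injective_linearMap f hf)
    (LinearMap.lTensor_surjective B hg) (lTensor_exact B h hg)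

lemma hasProjectiveDimensionLE_tensorProduct (B : Type u) [CommRing B] [Algebra A B]
    [Module.Flat A B] (d : ℕ) (N : Type u) [AddCommGroup N] [Module A N]
    (h : HasProjectiveDimensionLE (ModuleCat.of A N) d) :
    HasProjectiveDimensionLE (ModuleCat.of B (B ⊗[A] N)) d := by
  induction d generalizing N with
  | zero =>
    have : Module.Projective A N := by
      rw [IsProjective.iff_projective]
      exact (projective_iff_hasProjectiveDimensionLE_zero _).mpr h
    rw [← projective_iff_hasProjectiveDimensionLE_zero, ← IsProjective.iff_projective]
    infer_instance
  | succ d ih =>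
    obtain ⟨F, _, _, _, g, hg⟩ : ∃ (F : Type u) (_ : AddCommGroup F) (_ : Module A F)
        (_ : Module.Free A F) (g : F →ₗ[A] N), Function.Surjective g :=
      ⟨N →₀ A, _, _, inferInstance, Finsupp.linearCombination A id,
        Finsupp.linearCombination_id_surjective A N⟩
    have hex := LinearMap.exact_subtype_ker_map g
    have hS := shortExact_of_linearMap (LinearMap.ker g).injective_subtype hg hex
    have hSB := shortExact_baseChange B (LinearMap.ker g).injective_subtype hg hex
    have hp : Projective (ModuleCat.of A F) := by
      rw [← IsProjective.iff_projective]; infer_instance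
    have hpB : Projective (ModuleCat.of B (B ⊗[A] F)) := by
      rw [← IsProjective.iff_projective]; infer_instance
    exact (hSB.hasProjectiveDimensionLT_X₃_iff d hpB).mpr
      (ih _ ((hS.hasProjectiveDimensionLT_X₃_iff d hp).mp h))

section

variable (A) (M : Type u) [AddCommGroup M] [Module A M] [Module A[X] M] [IsScalarTower A A[X] M]

/-- Multiplication by `X ⊗ 1 - 1 ⊗ X` on `A[X] ⊗ M`. -/
noncomputable def tensorXSub : A[X] ⊗[A] M →ₗ[A[X]] A[X] ⊗[A] M :=
  LinearMap.lsmul A[X] _ (Polynomial.X : A[X]) -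
    (((LinearMap.lsmul A[X] M (Polynomial.X : A[X])).restrictScalars A).baseChange A[X])

/-- The action `A[X] ⊗ M → M`. -/
noncomputable def tensorAct : A[X] ⊗[A] M →ₗ[A[X]] M :=
  TensorProduct.AlgebraTensorModule.lift
    ((LinearMap.lsmul A[X] M : A[X] →ₗ[A[X]] M →ₗ[A[X]] M).flip.restrictScalars A).flip

variable {A M}

@[simp] lemma tensorXSub_tmul (b : A[X]) (m : M) :
    tensorXSub A M (b ⊗ₜ m) = (Polynomial.X * b) ⊗ₜ m - b ⊗ₜ ((Polynomial.X : A[X]) • m) := by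
  simp [tensorXSub, TensorProduct.smul_tmul']

@[simp] lemma tensorAct_tmul (b : A[X]) (m : M) : tensorAct A M (b ⊗ₜ m) = b • m := by
  simp [tensorAct]

lemma tensorAct_surjective : Function.Surjective (tensorAct A M) :=
  fun m ↦ ⟨1 ⊗ₜ m, by simp⟩

/-- Modulo the image, X can be moved across the tensor sign, so every t is congruent to 1 ⊗ (its
image in M). -/
lemma exact_tensorXSub_tensorAct : Function.Exact (tensorXSub A M) (tensorAct A M) := by
  have h1 (t : A[X] ⊗[A] M) :
      t - 1 ⊗ₜ tensorAct A M t ∈ LinearMap.range (tensorXSub A M) := by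
    induction t with
    | zero => simp
    | add x y hx hy =>
      rw [map_add, TensorProduct.tmul_add, add_sub_add_comm]
      exact add_mem hx hy
    | tmul b m =>
      induction b using Polynomial.induction_on' with
      | add p q hp hq =>
        rw [TensorProduct.add_tmul, map_add, TensorProduct.tmul_add, add_sub_add_comm]
        exact add_mem hp hq
      | monomial i a =>
        induction i generalizing m with
        | zero =>
          have : (Polynomial.monomial 0 a : A[X]) = a • 1 := by
            rw [Polynomial.monomial_zero_left, Polynomial.smul_eq_C_mul, mul_one]
          simp [this, TensorProduct.smul_tmul]
        | succ i ih =>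
          have h2 := add_mem (ih ((Polynomial.X : A[X]) • m))
            (LinearMap.mem_range_self (tensorXSub A M) (Polynomial.monomial i a ⊗ₜ m))
          rw [tensorXSub_tmul, Polynomial.X_mul_monomial, tensorAct_tmul, smul_smul,
            Polynomial.monomial_mul_X] at h2
          rw [tensorAct_tmul]
          convert! h2 using 1
          abel
  intro t
  refine ⟨fun ht ↦ ?_, ?_⟩
  · simpa [ht] using h1 t
  · rintro ⟨s, rfl⟩
    induction s with
    | zero => simp
    | add x y hx hy => rw [map_add, map_add, hx, hy, add_zero]
    | tmul b m => simp [smul_smul, mul_comm]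

lemma tensorXSub_injective : Function.Injective (tensorXSub A M) := by
  rw [injective_iff_map_eq_zero]
  intro t ht
  let e := TensorProduct.equivFinsuppOfBasisLeft (N := M) (Polynomial.basisMonomials A)
  have hr (p : A[X]) (i : ℕ) : (Polynomial.basisMonomials A).repr p i = p.coeff i := rfl
  have h1 (s : A[X] ⊗[A] M) (i : ℕ) :
      e (tensorXSub A M s) (i + 1) = e s i - (Polynomial.X : A[X]) • e s (i + 1) := by
    induction s with
    | zero => simp
    | add x y hx hy => simp only [map_add, Finsupp.add_apply, hx, hy, smul_add]; abel
    | tmul b m =>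
      simp [e, hr, smul_algebra_smul_comm]
  -- By `h1`, a kernel element has coefficients t_i = X • t_{i+1}; they vanish in large degree,
  -- hence downwards in all degrees.
  have h2 (k i : ℕ) (hi : (e t).support.sup id < i + k) : e t i = 0 := by
    induction k generalizing i with
    | zero => exact Finsupp.notMem_support_iff.mp fun h ↦ (Finset.le_sup (f := id) h).not_gt hi
    | succ k ih =>
      have h3 := h1 t i
      rw [ih (i + 1) (by lia), ht] at h3
      simpa using h3.symm
  exact e.map_eq_zero_iff.mp (Finsupp.ext fun i ↦ h2 _ i (by lia : _ < i + ((e t).support.sup id + 1)))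

end

/-- The sequence 0 → A[X] ⊗ M → A[X] ⊗ M → M → 0 resolves M by modules of projective dimension at
most d, since A[X] is flat over A. -/
lemma hasProjectiveDimensionLE_polynomial (d : ℕ)
    (h : ∀ N : ModuleCat.{u} A, HasProjectiveDimensionLE N d) (M : ModuleCat.{u} A[X]) :
    HasProjectiveDimensionLE M (d + 1) := by
  let : Module A M := Module.compHom M (Polynomial.C : A →+* A[X])
  have : IsScalarTower A A[X] M := ⟨fun a p m ↦ by
    rw [Polynomial.smul_eq_C_mul, mul_smul]; rfl⟩
  have hT := hasProjectiveDimensionLE_tensorProduct A[X] d M (h (ModuleCat.of A M))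
  exact (shortExact_of_linearMap tensorXSub_injective (tensorAct_surjective (A := A) (M := M))
    exact_tensorXSub_tensorAct).hasProjectiveDimensionLT_X₃ (d + 1) hT
    (hasProjectiveDimensionLT_of_ge _ (d + 1) (d + 2) (by lia))

attribute [local instance] RingHomInvPair.of_ringEquiv in
lemma hasProjectiveDimensionLE_of_ringEquiv {A B : Type u} [CommRing A] [CommRing B] (e : A ≃+* B)
    (d : ℕ) (h : ∀ N : ModuleCat.{u} A, HasProjectiveDimensionLE N d) (M : ModuleCat.{u} B) :
    HasProjectiveDimensionLE M d := by
  let : Module A M := Module.compHom M (e : A →+* B)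
  let e' : ModuleCat.of A M ≃ₛₗ[RingHomClass.toRingHom e] M :=
    { AddEquiv.refl M with map_smul' := fun a m ↦ rfl }
  have := h (ModuleCat.of A M)
  exact ModuleCat.hasProjectiveDimensionLE_of_semiLinearEquiv e e' d

/-- Hilbert's syzygy theorem. -/
theorem hasProjectiveDimensionLE_mvPolynomial (k : Type u) [Field k] (n : ℕ)
    (M : ModuleCat.{u} (MvPolynomial (Fin n) k)) : HasProjectiveDimensionLE M n := by
  induction n with
  | zero =>
    refine hasProjectiveDimensionLE_of_ringEquiv (MvPolynomial.isEmptyRingEquiv k (Fin 0)).symm 0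
      (fun N ↦ ?_) M
    rw [← projective_iff_hasProjectiveDimensionLE_zero, ← IsProjective.iff_projective]
    have := Module.Free.of_divisionRing k N
    exact Module.Projective.of_free
  | succ n ih =>
    exact hasProjectiveDimensionLE_of_ringEquiv
      (MvPolynomial.finSuccEquiv k n).symm.toRingEquiv (n + 1)
      (hasProjectiveDimensionLE_polynomial n ih) M

end GlobalDimension


/-! ### Gradings described by projections -/

section Graded

variable {n : ℕ} {k : Type u} [Field k]

/-- A `ℤ`-grading of a module over the polynomial ring, given by the projections onto the
homogeneous components. -/
structure GradedProj (n : ℕ) (k : Type u) [Field k] (M : Type u) [AddCommGroup M]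
    [Module (Poly n k) M] where
  /-- the projection onto the component of a given degree -/
  proj : ℤ → M →+ M
  proj_proj : ∀ a b m, proj a (proj b m) = if a = b then proj b m else 0
  finite_support : ∀ m, (Function.support fun a ↦ proj a m).Finite
  finsum_proj : ∀ m, ∑ᶠ a, proj a m = m
  proj_smul : ∀ (i : ℕ) (a : ℤ) (f : Poly n k) (m : M), f.IsHomogeneous i →
    proj (i + a) (f • m) = f • proj a m

/-- The grading given by a direct sum decomposition. -/
noncomputable def IsGrading.gradedProj {M : Type u} [AddCommGroup M] [Module (Poly n k) M]
    {ℳ : ℤ → AddSubgroup M} (h : IsGrading (n := n) (k := k) ℳ) : GradedProj n k M :=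
  letI := h.isInternal.chooseDecomposition
  { proj := fun a ↦ (ℳ a).subtype.comp
      ((DFinsupp.evalAddMonoidHom a).comp (DirectSum.decomposeAddEquiv ℳ).toAddMonoidHom)
    proj_proj := fun a b m ↦ by
      change (DirectSum.decompose ℳ (DirectSum.decompose ℳ m b : M) a : M) =
        if a = b then (DirectSum.decompose ℳ m b : M) else 0
      split_ifs with hab
      · rw [hab, DirectSum.decompose_of_mem_same ℳ (SetLike.coe_mem _)]
      · rw [DirectSum.decompose_of_mem_ne ℳ (SetLike.coe_mem _) (Ne.symm hab)]
    finite_support := fun m ↦ by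
      refine (DFinsupp.finite_support (DirectSum.decompose ℳ m)).subset fun a ha ha' ↦ ha ?_
      exact congrArg Subtype.val ha'
    finsum_proj := fun m ↦ by
      classical
      change ∑ᶠ a, (DirectSum.decompose ℳ m a : M) = m
      conv_rhs => rw [← DirectSum.sum_support_decompose ℳ m]
      refine finsum_eq_sum_of_support_subset _ fun a ha ↦ ?_
      simpa using ha
    proj_smul := fun i a f m hf ↦ by
      classical
      change (DirectSum.decompose ℳ (f • m) (i + a) : M) = f • (DirectSum.decompose ℳ m a : M)
      conv_lhs => rw [← DirectSum.sum_support_decompose ℳ m, Finset.smul_sum,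
        DirectSum.decompose_sum, DFinsupp.finsetSum_apply, AddSubgroup.val_finsetSum]
      have h1 (b : ℤ) : (DirectSum.decompose ℳ (f • (DirectSum.decompose ℳ m b : M)) (i + a) : M) =
          if a = b then f • (DirectSum.decompose ℳ m b : M) else 0 := by
        have hmem := h.smul_mem i b f _ hf (SetLike.coe_mem (DirectSum.decompose ℳ m b))
        split_ifs with hab
        · rw [hab, DirectSum.decompose_of_mem_same ℳ hmem]
        · rw [DirectSum.decompose_of_mem_ne ℳ hmem (by lia)]
      rw [Finset.sum_congr rfl fun b _ ↦ h1 b, Finset.sum_ite_eq]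
      split_ifs with ha
      · rfl
      · rw [DFinsupp.notMem_support_iff.mp ha]
        simp }

section Polynomial

/-- The homogeneous component of a polynomial, indexed by the integers. -/
noncomputable def polyComponent (n : ℕ) (k : Type u) [Field k] (a : ℤ) : Poly n k →+ Poly n k :=
  if 0 ≤ a then (MvPolynomial.homogeneousComponent a.toNat).toAddMonoidHom else 0

lemma coeff_polyComponent (a : ℤ) (f : Poly n k) (d : Fin n →₀ ℕ) :
    (polyComponent n k a f).coeff d = if (d.degree : ℤ) = a then f.coeff d else 0 := by
  unfold polyComponent
  split_ifs with h1 h2 h2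
  · simp [MvPolynomial.coeff_homogeneousComponent, ← h2]
  · simp [MvPolynomial.coeff_homogeneousComponent]
    lia
  · lia
  · simp

lemma polyComponent_of_isHomogeneous {i : ℕ} {f : Poly n k} (hf : f.IsHomogeneous i) (a : ℤ) :
    polyComponent n k a f = if a = i then f else 0 := by
  ext d
  rw [coeff_polyComponent]
  by_cases hd : f.coeff d = 0
  · split_ifs <;> simp [hd]
  · have hdi : d.degree = i := not_imp_comm.mp hf.coeff_eq_zero hd
    rw [hdi]
    by_cases h : a = i
    · rw [if_pos h, if_pos h.symm]
    · rw [if_neg h, if_neg (Ne.symm h), MvPolynomial.coeff_zero]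

lemma support_polyComponent_subset (f : Poly n k) :
    (Function.support fun a ↦ polyComponent n k a f) ⊆
      (f.support.image fun d ↦ (d.degree : ℤ) : Finset ℤ) := fun a ha ↦ by
  obtain ⟨d, hd⟩ := MvPolynomial.ne_zero_iff.mp ha
  rw [coeff_polyComponent, ite_ne_right_iff] at hd
  simp only [Finset.coe_image, Set.mem_image]
  exact ⟨d, by simpa using hd.2, hd.1⟩

/-- The standard grading of the polynomial ring. -/
noncomputable def polyGrading (n : ℕ) (k : Type u) [Field k] : GradedProj n k (Poly n k) where
  proj := polyComponent n k
  proj_proj a b f := by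
    ext d
    rw [coeff_polyComponent, coeff_polyComponent]
    split_ifs <;> simp_all [coeff_polyComponent]
  finite_support f := (Finset.finite_toSet _).subset (support_polyComponent_subset f)
  finsum_proj f := by
    rw [finsum_eq_sum_of_support_subset _ (support_polyComponent_subset f)]
    ext d
    rw [MvPolynomial.coeff_sum]
    simp only [coeff_polyComponent, Finset.sum_ite_eq]
    split_ifs with h
    · rfl
    · by_contra hd
      exact h (Finset.mem_image_of_mem _ (MvPolynomial.mem_support_iff.mpr fun h0 ↦ hd h0.symm))
  proj_smul i a f m hf := by
    ext d
    simp only [coeff_polyComponent, smul_eq_mul, MvPolynomial.coeff_mul]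
    have h1 : ∀ x ∈ Finset.HasAntidiagonal.antidiagonal d, f.coeff x.1 *
        (if (x.2.degree : ℤ) = a then m.coeff x.2 else 0) =
        if (d.degree : ℤ) = i + a then f.coeff x.1 * m.coeff x.2 else 0 := fun x hx ↦ by
      by_cases hx1 : f.coeff x.1 = 0
      · simp [hx1]
      · have hdi : x.1.degree = i := not_imp_comm.mp hf.coeff_eq_zero hx1
        have hd : d.degree = x.1.degree + x.2.degree := by
          rw [← Finset.HasAntidiagonal.mem_antidiagonal.mp hx, map_add]
        rw [mul_ite, mul_zero]
        congr 1
        rw [eq_iff_iff]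
        lia
    rw [Finset.sum_congr rfl h1]
    split_ifs <;> simp

lemma polyComponent_polyComponent (a b : ℤ) (f : Poly n k) :
    polyComponent n k a (polyComponent n k b f) = if a = b then polyComponent n k b f else 0 :=
  (polyGrading n k).proj_proj a b f

lemma finite_support_polyComponent (f : Poly n k) :
    (Function.support fun a ↦ polyComponent n k a f).Finite :=
  (polyGrading n k).finite_support f

lemma finsum_polyComponent (f : Poly n k) : ∑ᶠ a, polyComponent n k a f = f :=
  (polyGrading n k).finsum_proj f

lemma polyComponent_add_smul {i : ℕ} {f : Poly n k} (hf : f.IsHomogeneous i) (a : ℤ)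
    (g : Poly n k) : polyComponent n k (i + a) (f • g) = f • polyComponent n k a g :=
  (polyGrading n k).proj_smul i a f g hf

lemma polyComponent_zero (f : Poly n k) :
    polyComponent n k 0 f = MvPolynomial.C (MvPolynomial.coeff 0 f) := by
  simp [polyComponent]

end Polynomial

namespace GradedProj

variable {M : Type u} [AddCommGroup M] [Module (Poly n k) M] (G : GradedProj n k M)

lemma proj_smul_proj (a b : ℤ) (f : Poly n k) (m : M) :
    G.proj a (f • G.proj b m) = polyComponent n k (a - b) f • G.proj b m := by
  induction f using MvPolynomial.induction_on' with
  | monomial u c =>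
    have hu := MvPolynomial.isHomogeneous_monomial (R := k) (d := u) c rfl
    rw [polyComponent_of_isHomogeneous hu]
    have h := G.proj_smul _ (a - u.degree) _ (G.proj b m) hu
    rw [add_sub_cancel, G.proj_proj] at h
    rw [h, ite_smul, zero_smul, smul_ite, smul_zero]
    congr 1
    rw [eq_iff_iff]
    lia
  | add p q hp hq => rw [add_smul, map_add, hp, hq, map_add, add_smul]

/-- The direct sum of shifts of the polynomial ring. -/
noncomputable def pi {ι : Type u} [Finite ι] (d : ι → ℤ) : GradedProj n k (ι → Poly n k) where
  proj a := AddMonoidHom.mk' (fun f i ↦ polyComponent n k (a - d i) (f i))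
    fun f g ↦ by ext1 i; exact map_add _ _ _
  proj_proj a b f := by
    ext1 i
    change polyComponent n k (a - d i) (polyComponent n k (b - d i) (f i)) = _
    rw [polyComponent_polyComponent]
    by_cases h : a = b
    · rw [if_pos h, if_pos (by rw [h])]
      rfl
    · rw [if_neg h, if_neg (by lia)]
      rfl
  finite_support f := by
    refine (Set.finite_iUnion fun i ↦ (finite_support_polyComponent (f i)).image (· + d i)).subset
      fun a ha ↦ ?_
    obtain ⟨i, hi⟩ := Function.ne_iff.mp ha
    exact Set.mem_iUnion.mpr ⟨i, a - d i, hi, sub_add_cancel _ _⟩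
  finsum_proj f := by
    have hfin : (Function.support fun a ↦ fun i ↦ polyComponent n k (a - d i) (f i)).Finite := by
      refine (Set.finite_iUnion fun i ↦
        (finite_support_polyComponent (f i)).image (· + d i)).subset fun a ha ↦ ?_
      obtain ⟨i, hi⟩ := Function.ne_iff.mp ha
      exact Set.mem_iUnion.mpr ⟨i, a - d i, hi, sub_add_cancel _ _⟩
    ext1 i
    conv_rhs => rw [← finsum_polyComponent (f i), ← finsum_comp_equiv (Equiv.subRight (d i))]
    exact (Pi.evalAddMonoidHom (fun _ ↦ Poly n k) i).map_finsum hfin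
  proj_smul i a f m hf := by
    ext1 j
    change polyComponent n k (i + a - d j) (f • m j) = f • polyComponent n k (a - d j) (m j)
    rw [← polyComponent_add_smul hf, add_sub_assoc]

/-- A submodule stable under the projections is graded. -/
noncomputable def submodule (K : Submodule (Poly n k) M) (hK : ∀ a, ∀ x ∈ K, G.proj a x ∈ K) :
    GradedProj n k K where
  proj a := AddMonoidHom.mk' (fun x ↦ ⟨G.proj a x, hK a x x.2⟩)
    fun x y ↦ Subtype.ext (map_add _ _ _)
  proj_proj a b x := Subtype.ext <| by
    change G.proj a (G.proj b x) = _
    rw [G.proj_proj]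
    split_ifs <;> rfl
  finite_support x := (G.finite_support x).subset fun a ha ha' ↦ ha (Subtype.ext ha')
  finsum_proj x := Subtype.ext <| by
    rw [← Submodule.subtype_apply, ← LinearMap.toAddMonoidHom_coe, AddMonoidHom.map_finsum]
    · exact G.finsum_proj x
    · exact (G.finite_support x).subset fun a ha ha' ↦ ha (Subtype.ext ha')
  proj_smul i a f x hf := Subtype.ext (G.proj_smul i a f x hf)

end GradedProj

end Graded


/-! ### Graded modules: vanishing of Ext is detected at 𝔪 -/

section GradedExt

variable {n : ℕ} {k : Type u} [Field k]

namespace GradedProj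

variable {M : Type u} [AddCommGroup M] [Module (Poly n k) M] (G : GradedProj n k M)

/-- The homogeneous components of finitely many generators are again finitely many generators;
shifting the basis by their degrees makes the map graded. -/
lemma exists_free_presentation [Module.Finite (Poly n k) M] :
    ∃ (F : Type u) (_ : AddCommGroup F) (_ : Module (Poly n k) F) (_ : Module.Free (Poly n k) F)
      (_ : Module.Finite (Poly n k) F) (GF : GradedProj n k F) (g : F →ₗ[Poly n k] M),
      Function.Surjective g ∧ ∀ a x, g (GF.proj a x) = G.proj a (g x) := by
  classical
  obtain ⟨s, hs⟩ := Module.Finite.fg_top (R := Poly n k) (M := M)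
  let T : Set ℤ := ⋃ x : s, Function.support fun a ↦ G.proj a x
  have hT : T.Finite := Set.finite_iUnion fun x ↦ G.finite_support x
  have := hT.to_subtype
  let ι : Type u := s × T
  have : Fintype ι := Fintype.ofFinite ι
  let γ : ι → M := fun i ↦ G.proj i.2 i.1
  let g : (ι → Poly n k) →ₗ[Poly n k] M := Fintype.linearCombination (Poly n k) γ
  refine ⟨ι → Poly n k, inferInstance, inferInstance, inferInstance, inferInstance,
    pi fun i ↦ i.2, g, ?_, fun a x ↦ ?_⟩
  · rw [← LinearMap.range_eq_top, Fintype.range_linearCombination, eq_top_iff, ← hs,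
      Submodule.span_le]
    intro x hx
    rw [SetLike.mem_coe, ← G.finsum_proj x]
    refine finsum_induction (p := (· ∈ Submodule.span (Poly n k) (Set.range γ)))
      (Submodule.zero_mem _) (fun _ _ ↦ Submodule.add_mem _) fun a ↦ ?_
    by_cases ha : G.proj a x = 0
    · rw [ha]
      exact Submodule.zero_mem _
    · exact Submodule.subset_span ⟨⟨⟨x, hx⟩, ⟨a, Set.mem_iUnion.mpr ⟨⟨x, hx⟩, ha⟩⟩⟩, rfl⟩
  · simp only [g, Fintype.linearCombination_apply, map_sum]
    refine Finset.sum_congr rfl fun i _ ↦ ?_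
    rw [G.proj_smul_proj]
    rfl

variable (φ : M →ₗ[Poly n k] Poly n k) (j : ℤ)

lemma finite_support_comp (x : M) :
    (Function.support fun a ↦ polyComponent n k (a + j) (φ (G.proj a x))).Finite :=
  (G.finite_support x).subset fun a ha ha' ↦ ha (by
    have : G.proj a x = 0 := ha'
    simp only [this, map_zero])

/-- The component of degree `j` of a linear form on a graded module. -/
noncomputable def formComponent : M →ₗ[Poly n k] Poly n k where
  toFun x := ∑ᶠ a, polyComponent n k (a + j) (φ (G.proj a x))
  map_add' x y := by
    simp only [map_add]
    exact finsum_add_distrib (G.finite_support_comp φ j x) (G.finite_support_comp φ j y)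
  map_smul' f x := by
    induction f using MvPolynomial.induction_on' with
    | monomial u c =>
      have hu := MvPolynomial.isHomogeneous_monomial (R := k) (d := u) c rfl
      rw [← finsum_comp_equiv (Equiv.addLeft (u.degree : ℤ)), RingHom.id_apply, smul_finsum]
      refine finsum_congr fun a ↦ ?_
      rw [Equiv.coe_addLeft, G.proj_smul _ _ _ _ hu, map_smul, add_assoc,
        polyComponent_add_smul hu]
    | add p q hp hq =>
      simp only [add_smul, map_add]
      rw [finsum_add_distrib (G.finite_support_comp φ j _) (G.finite_support_comp φ j _), hp, hq]

lemma formComponent_apply (x : M) :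
    G.formComponent φ j x = ∑ᶠ a, polyComponent n k (a + j) (φ (G.proj a x)) := rfl

lemma formComponent_proj (a : ℤ) (x : M) :
    G.formComponent φ j (G.proj a x) = polyComponent n k (a + j) (φ (G.proj a x)) := by
  rw [formComponent_apply, finsum_eq_single _ a fun b hb ↦ by
    rw [G.proj_proj, if_neg hb, map_zero, map_zero], G.proj_proj, if_pos rfl]

lemma linearMap_ext_proj {N : Type*} [AddCommGroup N] [Module (Poly n k) N]
    {φ ψ : M →ₗ[Poly n k] N} (h : ∀ a x, φ (G.proj a x) = ψ (G.proj a x)) : φ = ψ := by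
  ext x
  rw [← G.finsum_proj x]
  have := G.finite_support x
  rw [← LinearMap.toAddMonoidHom_coe, AddMonoidHom.map_finsum _ this,
    ← LinearMap.toAddMonoidHom_coe, AddMonoidHom.map_finsum _ this]
  exact finsum_congr fun a ↦ h a x

/-- A form homogeneous of degree j keeps its degree only under the constant term of f. This is how a
multiplier outside 𝔪 gets replaced by a nonzero scalar. -/
lemma formComponent_smul_formComponent (f : Poly n k) :
    G.formComponent (f • G.formComponent φ j) j =
      polyComponent n k 0 f • G.formComponent φ j := by
  refine G.linearMap_ext_proj fun a x ↦ ?_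
  rw [formComponent_proj, LinearMap.smul_apply, LinearMap.smul_apply, formComponent_proj]
  exact ((polyGrading n k).proj_smul_proj _ _ _ _).trans (by rw [sub_self]; rfl)

lemma formComponent_comp {M' : Type u} [AddCommGroup M'] [Module (Poly n k) M']
    (G' : GradedProj n k M') (g : M' →ₗ[Poly n k] M) (hg : ∀ a x, g (G'.proj a x) = G.proj a (g x)) :
    G'.formComponent (φ ∘ₗ g) j = G.formComponent φ j ∘ₗ g := by
  refine G'.linearMap_ext_proj fun a x ↦ ?_
  rw [formComponent_proj, LinearMap.comp_apply, LinearMap.comp_apply, hg, formComponent_proj]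

/-- Allowing every larger J lets the sets belonging to finitely many generators be merged. -/
lemma exists_sum_formComponent_apply (x : M) :
    ∃ J₀ : Finset ℤ, ∀ J, J₀ ⊆ J → ∑ j ∈ J, G.formComponent φ j x = φ x := by
  classical
  let A := (G.finite_support x).toFinset
  let B (a : ℤ) := (finite_support_polyComponent (φ (G.proj a x))).toFinset
  refine ⟨A.biUnion fun a ↦ (B a).image (· - a), fun J hJ ↦ ?_⟩
  have h1 (j : ℤ) : G.formComponent φ j x =
      ∑ a ∈ A, polyComponent n k (a + j) (φ (G.proj a x)) := by
    refine finsum_eq_sum_of_support_subset _ fun a ha ↦ ?_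
    simp only [A, Set.Finite.coe_toFinset, Function.mem_support]
    exact fun h0 ↦ ha (by simp only [h0, map_zero])
  have h2 (a : ℤ) (ha : a ∈ A) :
      ∑ j ∈ J, polyComponent n k (a + j) (φ (G.proj a x)) = φ (G.proj a x) := by
    conv_rhs => rw [← finsum_polyComponent (φ (G.proj a x)),
      ← finsum_comp_equiv (Equiv.addLeft a)]
    refine (finsum_eq_sum_of_support_subset _ fun j hj ↦ hJ ?_).symm
    refine Finset.mem_biUnion.mpr ⟨a, ha, Finset.mem_image.mpr ⟨a + j, ?_, by lia⟩⟩
    simpa [B] using! hj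
  rw [Finset.sum_congr rfl fun j _ ↦ h1 j, Finset.sum_comm, Finset.sum_congr rfl h2, ← map_sum]
  congr 1
  conv_rhs => rw [← G.finsum_proj x]
  exact (finsum_eq_sum_of_support_subset _ (by simp [A])).symm

lemma exists_sum_formComponent [Module.Finite (Poly n k) M] :
    ∃ J : Finset ℤ, ∑ j ∈ J, G.formComponent φ j = φ := by
  classical
  obtain ⟨s, hs⟩ := Module.Finite.fg_top (R := Poly n k) (M := M)
  choose J₀ hJ₀ using G.exists_sum_formComponent_apply φ
  refine ⟨s.biUnion J₀, LinearMap.ext_on hs fun x hx ↦ ?_⟩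
  rw [LinearMap.sum_apply]
  exact hJ₀ x _ (Finset.subset_biUnion_of_mem J₀ hx)

end GradedProj

lemma idealOfVars_eq_ker :
    MvPolynomial.idealOfVars (Fin n) k = RingHom.ker (MvPolynomial.constantCoeff (σ := Fin n)) := by
  ext f
  rw [← pow_one (MvPolynomial.idealOfVars (Fin n) k), MvPolynomial.mem_pow_idealOfVars_iff',
    RingHom.mem_ker, MvPolynomial.constantCoeff_eq]
  refine ⟨fun h ↦ h 0 (by simp), fun h d hd ↦ ?_⟩
  rw [Nat.lt_one_iff, Finsupp.degree_eq_zero_iff] at hd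
  rw [hd, h]

/-- The homogeneous maximal ideal, as a point of the spectrum. -/
noncomputable def irrelevant (n : ℕ) (k : Type u) [Field k] : PrimeSpectrum (Poly n k) :=
  ⟨MvPolynomial.idealOfVars (Fin n) k, by
    rw [idealOfVars_eq_ker]
    exact RingHom.ker_isPrime _⟩

lemma coeff_zero_ne_zero_of_notMem {f : Poly n k} (hf : f ∉ (irrelevant n k).asIdeal) :
    MvPolynomial.coeff 0 f ≠ 0 := fun h ↦ hf <| by
  change f ∈ MvPolynomial.idealOfVars (Fin n) k
  rwa [idealOfVars_eq_ker, RingHom.mem_ker, MvPolynomial.constantCoeff_eq]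

/-- The linear form on `M` underlying an element of `Ext⁰`. -/
noncomputable def extZeroEquiv {R : Type u} [CommRing R] (M N : Type u) [AddCommGroup M]
    [Module R M] [AddCommGroup N] [Module R N] : ExtR R M N 0 ≃ₗ[R] (M →ₗ[R] N) :=
  Abelian.Ext.linearEquiv₀.trans ModuleCat.homLinearEquiv

lemma extZeroEquiv_extMapFst {R : Type u} [CommRing R] {M M' N : Type u} [AddCommGroup M]
    [Module R M] [AddCommGroup M'] [Module R M'] [AddCommGroup N] [Module R N] (f : M →ₗ[R] M')
    (x : ExtR R M' N 0) :
    extZeroEquiv M N (extMapFst f N 0 x) = extZeroEquiv M' N x ∘ₗ f := by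
  obtain ⟨φ, rfl⟩ := (Abelian.Ext.linearEquiv₀ (R := R)).symm.surjective x
  have h : extMapFst f N 0 ((Abelian.Ext.linearEquiv₀ (R := R)).symm φ) =
      (Abelian.Ext.linearEquiv₀ (R := R)).symm (ModuleCat.ofHom f ≫ φ) := by
    simp only [Abelian.Ext.linearEquiv₀_symm_apply]
    exact Abelian.Ext.mk₀_comp_mk₀ _ _
  rw [h]
  simp only [extZeroEquiv, LinearEquiv.trans_apply, LinearEquiv.apply_symm_apply]
  rfl

/-- A graded module `Ext^i(M, S)` with `M` finitely generated graded vanishes if it vanishes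
locally at the homogeneous maximal ideal. -/
lemma GradedProj.subsingleton_ext_of_irrelevant_notMem_support (i : ℕ) {M : Type u}
    [AddCommGroup M] [Module (Poly n k) M] [Module.Finite (Poly n k) M] (G : GradedProj n k M)
    (h : irrelevant n k ∉ Module.support (Poly n k) (ExtR (Poly n k) M (Poly n k) i)) :
    Subsingleton (ExtR (Poly n k) M (Poly n k) i) := by
  induction i using Nat.twoStepInduction generalizing M with
  | zero =>
    -- Hom(M, S) is torsion-free, so no grading is needed here.
    rw [(extZeroEquiv M (Poly n k)).support_eq, Module.notMem_support_iff'] at h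
    refine (extZeroEquiv M (Poly n k)).subsingleton_congr.mpr
      (subsingleton_of_forall_eq 0 fun φ ↦ ?_)
    obtain ⟨s, hs, hsφ⟩ := h φ
    refine (smul_eq_zero.mp hsφ).resolve_left ?_
    rintro rfl
    exact hs (Submodule.zero_mem _)
  | one =>
    obtain ⟨F, _, _, _, _, GF, g, hg, hgG⟩ := G.exists_free_presentation
    have hex := LinearMap.exact_subtype_ker_map g
    have hinj := (LinearMap.ker g).injective_subtype
    let GK := GF.submodule (LinearMap.ker g) fun a x hx ↦ by
      rw [LinearMap.mem_ker, hgG, LinearMap.mem_ker.mp hx, map_zero]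
    obtain ⟨-, -, -, -, -, hsurj⟩ := exists_exact_of_projective (Poly n k) hinj hg hex
    let δ := extδFst hinj hg hex (Poly n k) 0
    have hδ (j : ℤ) (φ : LinearMap.ker g →ₗ[Poly n k] Poly n k) :
        δ ((extZeroEquiv _ _).symm (GK.formComponent φ j)) = 0 := by
      -- Some s outside 𝔪 kills the class of φ_j, so s φ_j extends to a form ψ on F. In degree j
      -- this says that s₀ φ_j extends to ψ_j, and the constant term s₀ is a unit.
      obtain ⟨s, hs, hsφ⟩ := Module.notMem_support_iff'.mp h
        (δ ((extZeroEquiv _ _).symm (GK.formComponent φ j)))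
      rw [← map_smul, ← map_smul] at hsφ
      obtain ⟨ψ, hψ⟩ := (exact_extMapFst_extδFst (N := Poly n k) hinj hg hex 0 _).mp hsφ
      have h1 := extZeroEquiv_extMapFst (LinearMap.ker g).subtype ψ
      rw [hψ, LinearEquiv.apply_symm_apply] at h1
      have h2 := congrArg (GK.formComponent · j) h1
      simp only [formComponent_smul_formComponent] at h2
      rw [GF.formComponent_comp _ j GK _ fun _ _ ↦ rfl, polyComponent_zero] at h2
      have h3 : δ ((extZeroEquiv _ _).symm
          ((MvPolynomial.C (MvPolynomial.coeff 0 s) : Poly n k) • GK.formComponent φ j)) = 0 := by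
        refine (exact_extMapFst_extδFst (N := Poly n k) hinj hg hex 0 _).mpr
          ⟨(extZeroEquiv _ _).symm (GF.formComponent (extZeroEquiv _ _ ψ) j), ?_⟩
        apply (extZeroEquiv _ _).injective
        rw [extZeroEquiv_extMapFst, LinearEquiv.apply_symm_apply, LinearEquiv.apply_symm_apply, h2]
      rw [map_smul, map_smul] at h3
      have hu : IsUnit (MvPolynomial.C (MvPolynomial.coeff 0 s) : Poly n k) :=
        (coeff_zero_ne_zero_of_notMem hs).isUnit.map MvPolynomial.C
      exact hu.smul_eq_zero.mp h3
    refine subsingleton_of_forall_eq 0 fun x ↦ ?_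
    obtain ⟨y, rfl⟩ := hsurj x
    obtain ⟨J, hJ⟩ := GK.exists_sum_formComponent (extZeroEquiv _ _ y)
    rw [← (extZeroEquiv _ _).symm_apply_apply y, ← hJ, map_sum, map_sum]
    exact Finset.sum_eq_zero fun j _ ↦ hδ j _
  | more i _ ih =>
    obtain ⟨F, _, _, _, _, GF, g, hg, hgG⟩ := G.exists_free_presentation
    have hex := LinearMap.exact_subtype_ker_map g
    have hinj := (LinearMap.ker g).injective_subtype
    let GK := GF.submodule (LinearMap.ker g) fun a x hx ↦ by
      rw [LinearMap.mem_ker, hgG, LinearMap.mem_ker.mp hx, map_zero]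
    obtain ⟨e⟩ := nonempty_extEquiv_of_projective (Poly n k) hinj hg hex i
    have := ih GK (by rwa [e.support_eq])
    exact e.symm.toEquiv.subsingleton

end GradedExt


/-! ### Regular sequences, Rees' theorem, depth of S -/

section Depth

variable {n : ℕ} {k : Type u} [Field k]

lemma isRegular_ofFn_X : RingTheory.Sequence.IsRegular (Poly n k)
    (List.ofFn (MvPolynomial.X : Fin n → Poly n k)) := by
  refine ⟨(RingTheory.Sequence.isWeaklyRegular_iff_Fin _ _).mpr fun i ↦ ?_, ?_⟩
  · have hi : (i : ℕ) < n := by simpa using i.2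
    have hI : Ideal.ofList ((List.ofFn (MvPolynomial.X : Fin n → Poly n k)).take i) =
        Ideal.span (MvPolynomial.X '' {j : Fin n | (j : ℕ) < i}) := by
      refine congrArg Ideal.span (Set.ext fun f ↦ ?_)
      simp only [Set.mem_ofPred_eq, List.mem_take_iff_getElem, List.getElem_ofFn, Set.mem_image]
      constructor
      · rintro ⟨j, hj, rfl⟩
        exact ⟨⟨j, by simp at hj; lia⟩, by simp at hj ⊢; lia, rfl⟩
      · rintro ⟨j, hj, rfl⟩
        exact ⟨j, by simp at hj ⊢; lia, rfl⟩
    rw [hI, isSMulRegular_iff_right_eq_zero_of_smul]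
    intro q hq
    obtain ⟨f, rfl⟩ := Submodule.Quotient.mk_surjective _ q
    rw [← Submodule.Quotient.mk_smul, Submodule.Quotient.mk_eq_zero] at hq
    rw [Submodule.Quotient.mk_eq_zero]
    simp only [Ideal.mul_top, Fin.getElem_fin, List.getElem_ofFn, smul_eq_mul,
      MvPolynomial.mem_ideal_span_X_image] at hq ⊢
    intro d hd
    -- Membership in an ideal generated by variables is tested on monomials, and multiplying by X_i
    -- leaves the exponents of the earlier variables unchanged.
    obtain ⟨j, hj, hdj⟩ := hq (Finsupp.single ⟨i, hi⟩ 1 + d) (by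
      rw [MvPolynomial.mem_support_iff, MvPolynomial.coeff_X_mul]
      exact MvPolynomial.mem_support_iff.mp hd)
    refine ⟨j, hj, ?_⟩
    have hne : (⟨i, hi⟩ : Fin n) ≠ j := by
      rintro rfl
      exact lt_irrefl (i : ℕ) hj
    simpa [Finsupp.single_apply, hne] using hdj
  · intro h
    have h1 : (1 : Poly n k) ∈ Ideal.ofList (List.ofFn (MvPolynomial.X : Fin n → Poly n k)) := by
      have : (1 : Poly n k) ∈ (⊤ : Submodule (Poly n k) (Poly n k)) := trivial
      rw [h] at this
      simpa using this
    have h2 : Ideal.ofList (List.ofFn (MvPolynomial.X : Fin n → Poly n k)) ≤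
        (irrelevant n k).asIdeal := by
      refine Ideal.span_le.mpr fun f hf ↦ ?_
      obtain ⟨j, rfl⟩ := (List.mem_ofFn' _ _).mp hf
      exact Ideal.subset_span ⟨j, rfl⟩
    exact (irrelevant n k).2.ne_top ((Ideal.eq_top_iff_one _).mpr (h2 h1))

variable {E : Type u} [AddCommGroup E] [Module (Poly n k) E] [Module.Finite (Poly n k) E]

lemma smul_top_lt_top_of_mem_support {R : Type*} [CommRing R] {E : Type*} [AddCommGroup E]
    [Module R E] [Module.Finite R E] {p : PrimeSpectrum R} (h : p ∈ Module.support R E) :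
    p.asIdeal • (⊤ : Submodule R E) < ⊤ := by
  refine lt_top_iff_ne_top.mpr fun h0 ↦ ?_
  have h1 : p ∈ Module.support R (E ⧸ (p.asIdeal • ⊤ : Submodule R E)) := by
    rw [Module.support_quotient]
    exact ⟨h, (PrimeSpectrum.mem_zeroLocus _ _).mpr subset_rfl⟩
  have := Submodule.Quotient.subsingleton_iff.mpr h0
  simp [Module.support_eq_empty] at h1

lemma support_quotient_self {R : Type*} [CommRing R] (I : Ideal R) :
    Module.support R (R ⧸ I) = PrimeSpectrum.zeroLocus I := by
  rw [Module.support_eq_zeroLocus, Ideal.annihilator_quotient]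

/-- Rees' theorem: regular sequences detect the vanishing of `Ext`. -/
lemma le_depth_iff (h : irrelevant n k ∈ Module.support (Poly n k) E) (r : ℕ) :
    (r : ℕ∞) ≤ depth n k E ↔ ExtVanishesBelow (irrelevant n k).asIdeal r E := by
  have hnt : Nontrivial E := Module.nonempty_support_iff.mp ⟨_, h⟩
  have hlt := smul_top_lt_top_of_mem_support h
  have hsupp := support_quotient_self (irrelevant n k).asIdeal
  rw [depth, depthIn, if_neg (not_subsingleton E)]
  constructor
  · intro hr
    rcases r with _ | r
    · exact .zero
    · have hr' : (r : ℕ∞) < _ := (Nat.cast_lt.mpr r.lt_succ_self).trans_le hr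
      obtain ⟨rs, hrs⟩ := lt_iSup_iff.mp hr'
      obtain ⟨⟨hmem, hreg⟩, hlen⟩ := lt_iSup_iff.mp hrs
      intro j hj
      refine ModuleCat.subsingleton_ext_of_exists_isRegular (irrelevant n k).asIdeal
        (ModuleCat.of _ (Poly n k ⧸ (irrelevant n k).asIdeal)) hsupp.le (ModuleCat.of _ E) hlt
        rs hmem hreg j ?_
      have : r < rs.length := by exact_mod_cast hlen
      lia
  · intro hr
    obtain ⟨rs, hlen, hmem, hreg⟩ := ModuleCat.exists_isRegular_of_exists_subsingleton_ext
      (irrelevant n k).asIdeal r (ModuleCat.of _ E) hlt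
      (ModuleCat.of _ (Poly n k ⧸ (irrelevant n k).asIdeal)) hsupp hr
    rw [← hlen]
    exact le_iSup₂_of_le rs ⟨hmem, hreg⟩ le_rfl

lemma depth_le_supportDim [Nontrivial E] :
    (depth n k E : WithBot ℕ∞) ≤ Module.supportDim (Poly n k) E := by
  obtain ⟨d, hd⟩ := WithBot.ne_bot_iff_exists.mp
    (Module.supportDim_ne_bot_of_nontrivial (Poly n k) E)
  rw [← hd, WithBot.coe_le_coe, depth, depthIn, if_neg (not_subsingleton E)]
  refine iSup₂_le fun rs hrs ↦ ?_
  have := length_le_supportDim_of_isRegular rs hrs.2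
  rw [← hd] at this
  exact_mod_cast this

lemma extVanishesBelow_poly :
    ExtVanishesBelow (irrelevant n k).asIdeal n (Poly n k) := by
  have h : irrelevant n k ∈ Module.support (Poly n k) (Poly n k) := by
    rw [Module.support_of_noZeroSMulDivisors]
    trivial
  intro j hj
  refine ModuleCat.subsingleton_ext_of_exists_isRegular (irrelevant n k).asIdeal
    (ModuleCat.of _ (Poly n k ⧸ (irrelevant n k).asIdeal)) (support_quotient_self _).le
    (ModuleCat.of _ (Poly n k)) (smul_top_lt_top_of_mem_support h) _ (fun f hf ↦ ?_)
    isRegular_ofFn_X j (by simpa using hj)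
  obtain ⟨j, rfl⟩ := (List.mem_ofFn' _ _).mp hf
  exact Ideal.subset_span ⟨j, rfl⟩

end Depth

/-! ### The equivalence -/

section Main

variable {n : ℕ} {k : Type u} [Field k] {M : Type u} [AddCommGroup M] [Module (Poly n k) M]

lemma subsingleton_ext_of_lt {i : ℕ} (hi : n < i) : Subsingleton (ExtS n k M i) := by
  have := hasProjectiveDimensionLE_mvPolynomial k n (ModuleCat.of _ M)
  exact HasProjectiveDimensionLT.subsingleton (ModuleCat.of (Poly n k) M) (n + 1) i hi _

lemma supportDim_le : Module.supportDim (Poly n k) M ≤ n := by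
  refine (Module.supportDim_le_ringKrullDim _ _).trans ?_
  rw [MvPolynomial.ringKrullDim_of_isNoetherianRing, ringKrullDim_eq_zero_of_field]
  simp

lemma conditionE_zero : ConditionE n k M 0 := fun i ↦ by simp

lemma IsSequentiallyCohenMacaulay.conditionE (h : IsSequentiallyCohenMacaulay n k M) (t : ℕ) :
    ConditionE n k M t := by
  intro i
  rcases h i with h | ⟨h1, h2⟩
  · rw [depth, depthIn, if_pos h]
    exact le_top
  · rw [← h1] at h2
    have h3 : depth n k (ExtS n k M i) + i = n := by exact_mod_cast h2
    generalize depth n k (ExtS n k M i) = d at h3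
    induction d with
    | top => simp
    | coe d =>
      norm_cast at h3 ⊢
      lia

lemma eDepth_eq_of_forall_conditionE (h : ∀ t, ConditionE n k M t) :
    eDepth n k M = n :=
  min_eq_left (le_iSup₂_of_le n (h n) le_rfl)

/-- The bound n ≤ t + 1 suffices for (c), because dim M ≤ n. -/
lemma exists_conditionE_of_eDepth_eq (h : eDepth n k M = n) :
    ∃ t, n ≤ t + 1 ∧ ConditionE n k M t := by
  rcases n with _ | n
  · exact ⟨0, by lia, conditionE_zero⟩
  · have h1 : (n : ℕ∞) < ⨆ (t : ℕ) (_ : ConditionE (n + 1) k M t), (t : ℕ∞) :=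
      (Nat.cast_lt.mpr n.lt_succ_self).trans_le (min_eq_left_iff.mp h)
    obtain ⟨t, ht⟩ := lt_iSup_iff.mp h1
    obtain ⟨hE, hlt⟩ := lt_iSup_iff.mp ht
    have : n < t := by exact_mod_cast hlt
    exact ⟨t, by lia, hE⟩

variable [Module.Finite (Poly n k) M]

lemma supportDim_ext_le {i d : ℕ} (hd : i + d = n) :
    Module.supportDim (Poly n k) (ExtS n k M i) ≤ d :=
  supportDim_le_of_coheight_lt fun p hp ↦
    coheight_add_le_of_mem_support_ext (N := Poly n k) (n := n)
      (fun M _ _ _ ↦ subsingleton_ext_of_lt n.lt_succ_self) (d + 1) i (by lia) M p hp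

/-- When all Ext below degree c vanish and all those above have full depth, so has the one in degree
c, with no depth assumption on it. -/
lemma extVanishesBelow_ext_of_forall_lt {c s : ℕ} (hs : s + c = n)
    (hlt : ∀ i < c, Subsingleton (ExtS n k M i))
    (hgt : ∀ i, c < i → ExtVanishesBelow (irrelevant n k).asIdeal (n - i) (ExtS n k M i)) :
    ExtVanishesBelow (irrelevant n k).asIdeal s (ExtS n k M c) := by
  rcases c with _ | c
  · have := (extVanishesBelow_poly (n := n) (k := k)).ext_zero s M fun i ↦
      (hgt (i + 1) (by lia)).mono (by lia)
    exact this.mono (by lia)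
  · have := hlt 0 (by lia)
    exact (extVanishesBelow_poly (n := n) (k := k)).ext_succ c s (by lia) M .of_subsingleton
      (fun i hi ↦ hlt (i + 1) (by lia)) fun i ↦ (hgt (c + i + 2) (by lia)).mono (by lia)

lemma ConditionE.isSequentiallyCohenMacaulay (G : GradedProj n k M) {t : ℕ}
    (hdim : Module.supportDim (Poly n k) M ≤ ((t + 1 : ℕ) : WithBot ℕ∞))
    (hE : ConditionE n k M t) : IsSequentiallyCohenMacaulay n k M := by
  have hvan (i : ℕ) (r : ℕ) (hr : r ≤ t) (hrn : r ≤ n - i) :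
      ExtVanishesBelow (irrelevant n k).asIdeal r (ExtS n k M i) := by
    by_cases h : irrelevant n k ∈ Module.support (Poly n k) (ExtS n k M i)
    · rw [← le_depth_iff h]
      exact le_trans (by exact_mod_cast le_min hr hrn) (hE i)
    · have := G.subsingleton_ext_of_irrelevant_notMem_support i h
      exact .of_subsingleton
  intro i
  by_cases hsupp : irrelevant n k ∈ Module.support (Poly n k) (ExtS n k M i)
  swap
  · exact .inl (G.subsingleton_ext_of_irrelevant_notMem_support i hsupp)
  right
  have hnt : Nontrivial (ExtS n k M i) := Module.nonempty_support_iff.mp ⟨_, hsupp⟩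
  have hin : i ≤ n := by
    by_contra hi
    exact not_subsingleton _ (subsingleton_ext_of_lt (k := k) (M := M) (not_le.mp hi))
  obtain ⟨s, hs⟩ := Nat.exists_eq_add_of_le' hin
  have hle := supportDim_ext_le (k := k) (M := M) (show i + s = n by lia)
  -- Ischebeck's theorem with dim M < t + 2 gives vanishing at 𝔪; the grading makes it global.
  have hzero (j : ℕ) (hj : j + (t + 2) ≤ n) : Subsingleton (ExtS n k M j) :=
    G.subsingleton_ext_of_irrelevant_notMem_support j
      (notMem_support_ext_of_supportDim_lt extVanishesBelow_poly (t + 2) M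
        (hdim.trans_lt (by exact_mod_cast (t + 1).lt_succ_self)) j hj)
  have hge : (s : ℕ∞) ≤ depth n k (ExtS n k M i) := by
    rw [le_depth_iff hsupp]
    by_cases hst : s ≤ t
    · exact hvan i s hst (by lia)
    -- The one degree where (E_t) falls short, by exactly one: a smaller i is excluded by `hzero`.
    · have his : i + (t + 1) = n := by
        by_contra hne
        exact not_subsingleton _ (hzero i (by lia))
      exact extVanishesBelow_ext_of_forall_lt (by lia) (fun j hj ↦ hzero j (by lia))
        fun j hj ↦ hvan j (n - j) (by lia) le_rfl
  have hdl := depth_le_supportDim (n := n) (k := k) (E := ExtS n k M i)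
  have hsd : (s : WithBot ℕ∞) ≤ depth n k (ExtS n k M i) := by exact_mod_cast hge
  have hd1 : Module.supportDim (Poly n k) (ExtS n k M i) = s :=
    le_antisymm hle (hsd.trans hdl)
  refine ⟨le_antisymm hdl (hd1.le.trans hsd), ?_⟩
  rw [hd1, hs]
  push_cast
  rfl

end Main

end EDepth

theorem proposition2 {k : Type u} [Field k] (n : ℕ)
    (M : Type u) [AddCommGroup M] [Module (EDepth.Poly n k) M]
    [Module.Finite (EDepth.Poly n k) M]
    (ℳ : ℤ → AddSubgroup M) (hℳ : EDepth.IsGrading (n := n) (k := k) ℳ) :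
    List.TFAE
      [EDepth.IsSequentiallyCohenMacaulay n k M,
        EDepth.eDepth n k M = (n : ℕ∞),
        ∃ t : ℕ, Module.supportDim (EDepth.Poly n k) M ≤ ((t + 1 : ℕ) : WithBot ℕ∞) ∧
          EDepth.ConditionE n k M t] := by
  tfae_have 1 → 2 := fun h ↦ EDepth.eDepth_eq_of_forall_conditionE h.conditionE
  tfae_have 2 → 3 := fun h ↦ by
    obtain ⟨t, ht, hE⟩ := EDepth.exists_conditionE_of_eDepth_eq h
    exact ⟨t, EDepth.supportDim_le.trans (by exact_mod_cast ht), hE⟩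
  tfae_have 3 → 1 := fun ⟨t, hdim, hE⟩ ↦
    EDepth.ConditionE.isSequentiallyCohenMacaulay hℳ.gradedProj hdim hE
  tfae_finish
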